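/- Let $G$ be a discrete group. An operator system is a self-adjoint linear subspace of a unital $C^*$-algebra containing the identity; a $G$-operator system is an operator system with an action of $G$ by unital complete order automorphisms. A $G$-operator system $M$ is $G$-injective if for every $G$-equivariant completely isometric unital completely positive (u.c.p.) map $\kappa\colon E\to F$ of $G$-operator systems and every $G$-equivariant u.c.p. map $\varphi\colon E\to M$ there is a $G$-equivariant u.c.p. map $\psi\colon F\to M$ with $\psi\circ\kappa=\varphi$. A $G$-injective envelope $I_G(S)$ of a $G$-operator system $S$ is a pair $(M,\kappa)$ where $M$ is a $G$-injective $G$-operator system and $\kappa\colon S\to M$ is a $G$-equivariant completely isometric u.c.p. map that is $G$-essential: every $G$-equivariant u.c.p. map $\varphi$ from $M$ to a $G$-operator system such that $\varphi\circ\kappa$ is completely isometric is itself completely isometric. For $G=\{1\}$ one obtains the injective envelope $I(S)$. For a discrete space $X$, let $B_X=c_0(X)+\mathbb{C}1\subseteq\ell^\infty(X)$. (If $X$ is infinite, this is the unitization of the non-unital $C^*$-algebra $c_0(X)$; if $X$ is finite, $c_0(X)$ is already unital and $B_X=c_0(X)=\ell^\infty(X)$.) If $G$ acts on $X$, then $G$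 acts on $\ell^\infty(X)$ and on $B_X$ by $(gf)(x)=f(g^{-1}x)$. (1) For every discrete $G$-space $X$ (the action plays no role here), $I(B_X)=\ell^\infty(X)$; that is, $\ell^\infty(X)$ with the inclusion map $B_X\hookrightarrow\ell^\infty(X)$ is an injective envelope of $B_X$. (2) If $X=G/H$ is the space of left cosets of an amenable subgroup $H$ of $G$, then $I_G(B_X)=\ell^\infty(G/H)$, where $\ell^\infty(G/H)$ carries the action of $G$ by left translation; that is, $\ell^\infty(G/H)$ with the inclusion map $B_X\hookrightarrow\ell^\infty(G/H)$ is a $G$-injective envelope of $B_X$. -/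

import Mathlib

open scoped ENNReal

universe u v w w₁ w₂

noncomputable section

/-! ### Operator systems -/

/-- An operator system: a self-adjoint complex linear subspace of a unital C⋆-algebra containing
the identity.  The order on the ambient C⋆-algebra is its usual one (`StarOrderedRing`
determines it uniquely). -/
structure OperatorSystem : Type (w + 1) where
  Ambient : Type w
  [cstarAlgebra : CStarAlgebra Ambient]
  [partialOrder : PartialOrder Ambient]
  [starOrderedRing : StarOrderedRing Ambient]
  carrier : Submodule ℂ Ambient
  one_mem' : (1 : Ambient) ∈ carrier
  star_mem' : ∀ {a : Ambient}, a ∈ carrier → star a ∈ carrier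

namespace OperatorSystem

attribute [instance] cstarAlgebra partialOrder starOrderedRing

/-- The underlying vector space of an operator system. -/
abbrev Elem (S : OperatorSystem.{w}) : Type w := S.carrier

/-- The identity of an operator system. -/
def unit (S : OperatorSystem.{w}) : S.Elem := ⟨1, S.one_mem'⟩

/-- An `n × n` matrix over `S`, regarded as an element of the C⋆-algebra of `n × n` matrices over
the ambient C⋆-algebra (which carries the C⋆-norm and the C⋆-algebraic order). -/
def toCStarMatrix (S : OperatorSystem.{w}) {n : ℕ} (M : Matrix (Fin n) (Fin n) S.Elem) :
    CStarMatrix (Fin n) (Fin n) S.Ambient :=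
  CStarMatrix.ofMatrix (M.map fun a => (a : S.Ambient))

variable {S : OperatorSystem.{w₁}} {T : OperatorSystem.{w₂}}

/-- Unital completely positive (u.c.p.) linear maps between operator systems. -/
structure IsUCP (φ : S.Elem →ₗ[ℂ] T.Elem) : Prop where
  map_unit : φ S.unit = T.unit
  map_nonneg : ∀ (n : ℕ) (M : Matrix (Fin n) (Fin n) S.Elem),
    0 ≤ S.toCStarMatrix M → 0 ≤ T.toCStarMatrix (M.map φ)

/-- Completely isometric linear maps between operator systems. -/
def IsCompleteIsometry (φ : S.Elem →ₗ[ℂ] T.Elem) : Prop :=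
  ∀ (n : ℕ) (M : Matrix (Fin n) (Fin n) S.Elem),
    ‖T.toCStarMatrix (M.map φ)‖ = ‖S.toCStarMatrix M‖

/-- A linear map that is the restriction of a unital ⋆-homomorphism is u.c.p. -/
theorem IsUCP.of_starAlgHom {φ : S.Elem →ₗ[ℂ] T.Elem} (Φ : S.Ambient →⋆ₐ[ℂ] T.Ambient)
    (h : ∀ a : S.Elem, (φ a : T.Ambient) = Φ a) : IsUCP φ where
  map_unit := Subtype.ext <| (h _).trans (map_one Φ)
  map_nonneg n M hM := by
    have h1 : 0 ≤ (S.toCStarMatrix M).map Φ :=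
      CompletelyPositiveMapClass.map_cstarMatrix_nonneg' Φ n _ hM
    have h2 : (S.toCStarMatrix M).map Φ = T.toCStarMatrix (M.map φ) := by
      ext i j
      exact (h (M i j)).symm
    rwa [h2] at h1

/-- The operator system underlying a unital ⋆-subalgebra of a unital C⋆-algebra. -/
def ofStarSubalgebra {A : Type w} [CStarAlgebra A] (B : StarSubalgebra ℂ A) :
    OperatorSystem.{w} :=
  letI : PartialOrder A := CStarAlgebra.spectralOrder A
  letI : StarOrderedRing A := CStarAlgebra.spectralOrderedRing A
  { Ambient := A
    carrier := Subalgebra.toSubmodule B.toSubalgebra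
    one_mem' := one_mem B
    star_mem' := fun ha => star_mem (s := B) ha }

end OperatorSystem

/-! ### Operator systems with a group action -/

/-- A `G`-operator system: an operator system with an action of the (discrete) group `G` by unital
complete order automorphisms.  Since the inverse of the action of `g` is the action of `g⁻¹`, it
suffices to require each element to act by a u.c.p. map. -/
structure GOperatorSystem (G : Type v) [Group G] : Type (max v (w + 1))
    extends OperatorSystem.{w} where
  act : Representation ℂ G toOperatorSystem.Elem
  act_isUCP : ∀ g : G, OperatorSystem.IsUCP (act g)

namespace GOperatorSystem

open OperatorSystem

variable {G : Type v} [Group G]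

/-- `G`-equivariant u.c.p. maps. -/
structure IsGMorphism {S : GOperatorSystem.{v, w₁} G} {T : GOperatorSystem.{v, w₂} G}
    (φ : S.Elem →ₗ[ℂ] T.Elem) : Prop where
  isUCP : IsUCP φ
  equivariant : ∀ (g : G) (a : S.Elem), φ (S.act g a) = T.act g (φ a)

/-- `(M, κ)` is an extension of `S`: the map `κ : S → M` is a completely isometric, `G`-equivariant
u.c.p. map. -/
structure IsExtension {S : GOperatorSystem.{v, w₁} G} {M : GOperatorSystem.{v, w₂} G}
    (κ : S.Elem →ₗ[ℂ] M.Elem) : Prop where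
  isGMorphism : IsGMorphism κ
  isCompleteIsometry : IsCompleteIsometry κ

/-- `S` is `G`-injective: every `G`-equivariant u.c.p. map `E → S` extends along every completely
isometric `G`-equivariant u.c.p. map `E → F`. -/
def IsGInjective (S : GOperatorSystem.{v, w₁} G) : Prop :=
  ∀ (E F : GOperatorSystem.{v, w} G) (κ : E.Elem →ₗ[ℂ] F.Elem) (φ : E.Elem →ₗ[ℂ] S.Elem),
    IsExtension κ → IsGMorphism φ →
      ∃ ψ : F.Elem →ₗ[ℂ] S.Elem, IsGMorphism ψ ∧ ψ ∘ₗ κ = φ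

/-- `(M, κ)` is `G`-essential: a `G`-equivariant u.c.p. map `φ` on `M` is completely isometric
whenever `φ ∘ κ` is. -/
def IsGEssential {S : GOperatorSystem.{v, w₁} G} {M : GOperatorSystem.{v, w₂} G}
    (κ : S.Elem →ₗ[ℂ] M.Elem) : Prop :=
  ∀ (N : GOperatorSystem.{v, w} G) (φ : M.Elem →ₗ[ℂ] N.Elem),
    IsGMorphism φ → IsCompleteIsometry (φ ∘ₗ κ) → IsCompleteIsometry φ

/-- `(M, κ)` is a `G`-injective envelope of `S`: it is a `G`-essential extension and `M` is
`G`-injective.  Both properties are tested on the `G`-operator systems in the universe `w`. -/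
structure IsGInjectiveEnvelope {S : GOperatorSystem.{v, w₁} G} {M : GOperatorSystem.{v, w₂} G}
    (κ : S.Elem →ₗ[ℂ] M.Elem) : Prop where
  isExtension : IsExtension κ
  isGEssential : IsGEssential.{v, w} κ
  isGInjective : IsGInjective.{v, w} M

end GOperatorSystem

namespace OperatorSystem

/-- An operator system with the action of the trivial group. -/
def withTrivialAction (S : OperatorSystem.{w}) : GOperatorSystem.{0, w} Unit where
  toOperatorSystem := S
  act := Representation.trivial ℂ Unit S.Elem
  act_isUCP _ := IsUCP.of_starAlgHom (StarAlgHom.id ℂ S.Ambient) fun _ => rfl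

/-- `(M, κ)` is an injective envelope of the operator system `S`: this is the notion of a
`G`-injective envelope for the trivial group `G = {1}`. -/
def IsInjectiveEnvelope {S : OperatorSystem.{w₁}} {M : OperatorSystem.{w₂}}
    (κ : S.Elem →ₗ[ℂ] M.Elem) : Prop :=
  GOperatorSystem.IsGInjectiveEnvelope.{0, w} (S := S.withTrivialAction)
    (M := M.withTrivialAction) κ

end OperatorSystem

/-! ### Bounded functions, functions vanishing at infinity and the unitization -/

/-- The C⋆-algebra `ℓ^∞(X)` of bounded complex functions on `X`. -/
abbrev EllInfty (X : Type u) : Type u := lp (fun _ : X => ℂ) ∞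

/-- `c₀(X)`, as a ⋆-subalgebra of `ℓ^∞(X)`: the functions vanishing at infinity on the discrete
space `X`. -/
def c₀ (X : Type u) : NonUnitalStarSubalgebra ℂ (EllInfty X) where
  carrier := {f | Filter.Tendsto (fun x => f x) Filter.cofinite (nhds 0)}
  zero_mem' := tendsto_const_nhds
  add_mem' {f g} hf hg := by simpa using Filter.Tendsto.add hf hg
  mul_mem' {f g} hf hg := by simpa using Filter.Tendsto.mul hf hg
  smul_mem' c f hf := by simpa using Filter.Tendsto.const_smul hf c
  star_mem' {f} hf := by simpa using Filter.Tendsto.star hf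

/-- The unitization of `c₀(X)`, realized as the unital ⋆-subalgebra `c₀(X) + ℂ1` of `ℓ^∞(X)`
generated by `c₀(X)`.  For infinite `X` this is the unitization of the non-unital algebra `c₀(X)`,
see `c₀UnitizationEquiv`; for finite `X`, `c₀(X)` is already unital and nothing is added. -/
def c₀Unitization (X : Type u) : StarSubalgebra ℂ (EllInfty X) :=
  StarAlgebra.adjoin ℂ (c₀ X : Set (EllInfty X))

theorem one_notMem_c₀ (X : Type u) [Infinite X] : (1 : EllInfty X) ∉ c₀ X := by
  intro h
  have h1 : Filter.Tendsto (fun _ : X => (1 : ℂ)) Filter.cofinite (nhds 0) := h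
  exact one_ne_zero (tendsto_nhds_unique tendsto_const_nhds h1)

set_option synthInstance.maxHeartbeats 400000 in
/-- For infinite `X`, `c₀Unitization X` is the unitization of `c₀(X)`. -/
def c₀UnitizationEquiv (X : Type u) [Infinite X] :
    Unitization ℂ (c₀ X) ≃⋆ₐ[ℂ] c₀Unitization X :=
  NonUnitalStarSubalgebra.unitizationStarAlgEquiv (c₀ X) (one_notMem_c₀ X)

/-- For finite `X`, `c₀(X)` is the unital algebra `ℓ^∞(X)`, and so is `c₀Unitization X`. -/
theorem c₀Unitization_eq_top (X : Type u) [Finite X] : c₀Unitization X = ⊤ :=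
  eq_top_iff.2 fun f _ => StarAlgebra.subset_adjoin ℂ _ <| by
    change Filter.Tendsto _ _ _
    simp [Filter.cofinite_eq_bot]

/-- `ℓ^∞(X)` as an operator system. -/
def ellInftySystem (X : Type u) : OperatorSystem.{u} :=
  OperatorSystem.ofStarSubalgebra (⊤ : StarSubalgebra ℂ (EllInfty X))

/-- The unitization of `c₀(X)` as an operator system. -/
def c₀UnitizationSystem (X : Type u) : OperatorSystem.{u} :=
  OperatorSystem.ofStarSubalgebra (c₀Unitization X)

/-- The inclusion of the unitization of `c₀(X)` in `ℓ^∞(X)`. -/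
def c₀UnitizationIncl (X : Type u) :
    (c₀UnitizationSystem X).Elem →ₗ[ℂ] (ellInftySystem X).Elem :=
  Submodule.inclusion fun _ _ => trivial

section Translation

variable (G : Type v) [Group G] (X : Type u) [MulAction G X]

variable {G X} in
/-- Translation of bounded functions on a `G`-space: `(g f)(x) = f(g⁻¹ x)`. -/
def ellInftyTranslate (g : G) : EllInfty X →⋆ₐ[ℂ] EllInfty X where
  toFun f := ⟨fun x => f (g⁻¹ • x), memℓp_infty <| by
    obtain ⟨C, hC⟩ := memℓp_infty_iff.1 (lp.memℓp f)
    exact ⟨C, by rintro _ ⟨x, rfl⟩; exact hC ⟨g⁻¹ • x, rfl⟩⟩⟩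
  map_one' := rfl
  map_mul' _ _ := rfl
  map_zero' := rfl
  map_add' _ _ := rfl
  commutes' _ := rfl
  map_star' _ := rfl

variable {G X}

@[simp] theorem ellInftyTranslate_apply (g : G) (f : EllInfty X) (x : X) :
    ellInftyTranslate g f x = f (g⁻¹ • x) := rfl

theorem ellInftyTranslate_one (f : EllInfty X) : ellInftyTranslate (1 : G) f = f := by
  ext x; simp

theorem ellInftyTranslate_mul (g h : G) (f : EllInfty X) :
    ellInftyTranslate (g * h) f = ellInftyTranslate g (ellInftyTranslate h f) := by
  ext x; simp [mul_smul]

theorem ellInftyTranslate_mem_c₀ (g : G) {f : EllInfty X} (hf : f ∈ c₀ X) : ellInftyTranslate g f ∈ c₀ X :=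
  Filter.Tendsto.comp (f := fun x => g⁻¹ • x) hf
    (MulAction.injective g⁻¹).tendsto_cofinite

theorem ellInftyTranslate_mem_c₀Unitization (g : G) {f : EllInfty X} (hf : f ∈ c₀Unitization X) :
    ellInftyTranslate g f ∈ c₀Unitization X := by
  have h : c₀Unitization X ≤ (c₀Unitization X).comap (ellInftyTranslate g) :=
    StarAlgebra.adjoin_le fun f hf => StarAlgebra.subset_adjoin ℂ _ (ellInftyTranslate_mem_c₀ g hf)
  exact h hf

/-- The `G`-operator system given by a translation invariant unital ⋆-subalgebra of `ℓ^∞(X)`, with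
the translation action. -/
def translationSystem (G : Type v) [Group G] [MulAction G X] (B : StarSubalgebra ℂ (EllInfty X))
    (hB : ∀ (g : G) (f : EllInfty X), f ∈ B → ellInftyTranslate g f ∈ B) :
    GOperatorSystem.{v, u} G where
  toOperatorSystem := OperatorSystem.ofStarSubalgebra B
  act :=
    { toFun := fun g => (ellInftyTranslate g : EllInfty X →⋆ₐ[ℂ] EllInfty X).toAlgHom.toLinearMap.restrict
          (p := Subalgebra.toSubmodule B.toSubalgebra)
          (q := Subalgebra.toSubmodule B.toSubalgebra) (hB g)
      map_one' := by
        apply LinearMap.ext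
        rintro ⟨f, hf⟩
        exact Subtype.ext (ellInftyTranslate_one f)
      map_mul' := fun g h => by
        apply LinearMap.ext
        rintro ⟨f, hf⟩
        exact Subtype.ext (ellInftyTranslate_mul g h f) }
  act_isUCP g := OperatorSystem.IsUCP.of_starAlgHom
    (S := OperatorSystem.ofStarSubalgebra B) (T := OperatorSystem.ofStarSubalgebra B)
    (ellInftyTranslate g) fun _ => rfl

variable (G X)

/-- `ℓ^∞(X)` as a `G`-operator system, with the translation action. -/
def ellInftyGSystem : GOperatorSystem.{v, u} G :=
  translationSystem G (⊤ : StarSubalgebra ℂ (EllInfty X)) fun _ _ _ => trivial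

/-- The unitization of `c₀(X)` as a `G`-operator system, with the translation action. -/
def c₀UnitizationGSystem : GOperatorSystem.{v, u} G :=
  translationSystem G (c₀Unitization X) fun g _ hf => ellInftyTranslate_mem_c₀Unitization g hf

/-- The inclusion of the unitization of `c₀(X)` in `ℓ^∞(X)`, as a map of `G`-operator systems. -/
def c₀UnitizationGIncl : (c₀UnitizationGSystem G X).Elem →ₗ[ℂ] (ellInftyGSystem G X).Elem :=
  c₀UnitizationIncl X

end Translation

/-! ### Amenability -/

/-- A discrete group is amenable if there is a left translation invariant mean on `ℓ^∞(H)`: a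
unital positive linear functional `m` such that `m (h f) = m f` for all `h` and `f`. -/
def IsAmenableGroup (H : Type v) [Group H] : Prop :=
  ∃ m : EllInfty H →ₗ[ℂ] ℂ, m 1 = 1 ∧
    (∀ f : EllInfty H, (∀ x, 0 ≤ (f x).re ∧ (f x).im = 0) → 0 ≤ (m f).re ∧ (m f).im = 0) ∧
    ∀ (h : H) (f : EllInfty H), m (ellInftyTranslate h f) = m f

end

/-!
The bounded functions on `X` are the injective envelope of `c₀(X) + ℂ1` because u.c.p. maps into
`ℓ^∞(X)` are the same thing as families of states indexed by `X`, and because the evaluation at a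
point is the only state of `ℓ^∞(X)` extending its restriction to `c₀(X) + ℂ1`.

*Injectivity.*  A state extends along a unital isometry by the Hahn–Banach theorem
(`IsState.exists_extension`): a unital functional is positive if and only if it is contractive.  Any
family of states is a u.c.p. map into `ℓ^∞(X)` (`isUCP_stateFamily`), so maps into `ℓ^∞(X)` extend
coordinate by coordinate.  A `G`-equivariant u.c.p. map into `ℓ^∞(G/H)` is determined by the
`H`-invariant state obtained by evaluating at the coset `H`; for amenable `H` the extension of this
state can be averaged to an `H`-invariant one (`exists_invariant_state`), which defines a
`G`-equivariant extension of the map (`isGInjective_ellInftyGSystem`).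

*Essentiality.*  Let `φ` be u.c.p. on `ℓ^∞(X)` and completely isometric on `c₀(X) + ℂ1`.  By
injectivity there is a u.c.p. map `ψ` into `ℓ^∞(X)` such that `ψ ∘ φ` is the identity on
`c₀(X) + ℂ1`.  The states `f ↦ ψ (φ f) x` are then evaluations (`IsState.eq_ellInftyEval`), so
`ψ ∘ φ` is the identity.  As u.c.p. maps are completely contractive (`IsUCP.norm_map_le`), `φ` is
completely isometric.  The group plays no role in this part.
-/

open scoped Matrix ComplexOrder

/-! ### Complete positivity and complete contractivity -/

namespace CStarAlgebra

/-- The library lemma `nonneg_iff_eq_star_mul_self`, with the functional calculus resolved for an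
abstract algebra, so that no instance search for it is needed on `CStarMatrix`. -/
theorem nonneg_iff_exists_star_mul_self {A : Type*} [NonUnitalCStarAlgebra A] [PartialOrder A]
    [StarOrderedRing A] {a : A} : 0 ≤ a ↔ ∃ b, a = star b * b :=
  nonneg_iff_eq_star_mul_self

theorem norm_le_iff_mul_star_le {A : Type*} [CStarAlgebra A] [PartialOrder A]
    [StarOrderedRing A] {a : A} {r : ℝ} (hr : 0 ≤ r) :
    ‖a‖ ≤ r ↔ 0 ≤ ((r ^ 2 : ℝ) : ℂ) • (1 : A) - a * star a := by
  rw [sub_nonneg, Complex.coe_smul, ← Algebra.algebraMap_eq_smul_one,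
    ← norm_le_iff_le_algebraMap _ (sq_nonneg r) (mul_star_self_nonneg a),
    CStarRing.norm_self_mul_star, ← sq, sq_le_sq₀ (norm_nonneg a) hr]

end CStarAlgebra

namespace CStarMatrix

/-- Positivity of a matrix over a C⋆-algebra, in purely algebraic terms. -/
theorem ofMatrix_nonneg_iff {n : Type*} [Fintype n] {A : Type*} [CStarAlgebra A] [PartialOrder A]
    [StarOrderedRing A] {M : Matrix n n A} : 0 ≤ ofMatrix M ↔ ∃ Q : Matrix n n A, M = Qᴴ * Q :=
  CStarAlgebra.nonneg_iff_exists_star_mul_self (a := ofMatrix M)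

end CStarMatrix

namespace OperatorSystem

variable {S : OperatorSystem.{w₁}} {T : OperatorSystem.{w₂}}

theorem toCStarMatrix_nonneg_iff {n : ℕ} {M : Matrix (Fin n) (Fin n) S.Elem} :
    0 ≤ S.toCStarMatrix M ↔
      ∃ Q : Matrix (Fin n) (Fin n) S.Ambient, M.map (fun a => (a : S.Ambient)) = Qᴴ * Q :=
  CStarMatrix.ofMatrix_nonneg_iff

/-- Complete positivity, for matrices indexed by an arbitrary finite type. -/
theorem IsUCP.map_nonneg_of_fintype {φ : S.Elem →ₗ[ℂ] T.Elem} (hφ : IsUCP φ) {n : Type*}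
    [Fintype n] {M : Matrix n n S.Elem} {Q : Matrix n n S.Ambient}
    (hQ : M.map (fun a => (a : S.Ambient)) = Qᴴ * Q) :
    ∃ R : Matrix n n T.Ambient, M.map (fun a => (φ a : T.Ambient)) = Rᴴ * R := by
  have e := Fintype.equivFin n
  obtain ⟨R, hR⟩ := toCStarMatrix_nonneg_iff.1 <| hφ.map_nonneg _ (M.submatrix e.symm e.symm) <|
    toCStarMatrix_nonneg_iff.2 ⟨Q.submatrix e.symm e.symm, by
      rw [← Matrix.submatrix_map, hQ, Matrix.conjTranspose_submatrix,
        Matrix.submatrix_mul_equiv]⟩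
  refine ⟨R.submatrix e e, ?_⟩
  rw [Matrix.conjTranspose_submatrix, Matrix.submatrix_mul_equiv, ← hR]
  ext i j
  simp

theorem IsUCP.nonneg {φ : S.Elem →ₗ[ℂ] T.Elem} (hφ : IsUCP φ) {a : S.Elem}
    (ha : 0 ≤ (a : S.Ambient)) : 0 ≤ (φ a : T.Ambient) := by
  obtain ⟨b, hb⟩ := CStarAlgebra.nonneg_iff_eq_star_mul_self.1 ha
  obtain ⟨R, hR⟩ := hφ.map_nonneg_of_fintype (M := Matrix.of fun _ _ : Unit => a)
    (Q := Matrix.of fun _ _ => b) (by ext i j; simp [Matrix.mul_apply, hb])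
  have h := congrFun (congrFun hR ()) ()
  simp only [Matrix.map_apply, Matrix.of_apply, Matrix.mul_apply, Finset.univ_unique,
    Finset.sum_singleton, Matrix.conjTranspose_apply] at h
  rw [h]
  exact star_mul_self_nonneg _

/-- A u.c.p. map is completely contractive.  With `r = ‖M‖` the block matrix `(r² M; M⋆ 1)` is
positive; so is its image `(r² N; N⋆ 1)`, and compressing the latter by the column `(1; -N⋆)` gives
`N N⋆ ≤ r²`. -/
theorem IsUCP.norm_map_le {φ : S.Elem →ₗ[ℂ] T.Elem} (hφ : IsUCP φ) {n : ℕ}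
    (M : Matrix (Fin n) (Fin n) S.Elem) : ‖T.toCStarMatrix (M.map φ)‖ ≤ ‖S.toCStarMatrix M‖ := by
  set r := ‖S.toCStarMatrix M‖ with hr
  let M₀ : Matrix (Fin n) (Fin n) S.Ambient := M.map fun a => (a : S.Ambient)
  let N : Matrix (Fin n) (Fin n) T.Ambient := M.map fun a => (φ a : T.Ambient)
  let c : ℂ := ((r ^ 2 : ℝ) : ℂ)
  obtain ⟨R, hR⟩ : ∃ R : Matrix (Fin n) (Fin n) S.Ambient,
      c • (1 : Matrix (Fin n) (Fin n) S.Ambient) - M₀ * M₀ᴴ = Rᴴ * R :=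
    CStarMatrix.ofMatrix_nonneg_iff.1 <|
      (CStarAlgebra.norm_le_iff_mul_star_le (norm_nonneg _)).1 hr.ge
  let P : Matrix (Fin n ⊕ Fin n) (Fin n ⊕ Fin n) S.Elem :=
    Matrix.fromBlocks (Matrix.of fun i j => if i = j then c • S.unit else 0) M
      (Matrix.of fun i j => ⟨star (M j i : S.Ambient), S.star_mem' (M j i).2⟩)
      (Matrix.of fun i j => if i = j then S.unit else 0)
  have hP : P.map (fun a => (a : S.Ambient)) = Matrix.fromBlocks (c • 1) M₀ M₀ᴴ 1 := by
    ext (i | i) (j | j) <;>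
      simp [P, M₀, Matrix.one_apply, apply_ite (Subtype.val), unit]
  -- `P` is positive because it is `Qᴴ * Q` for `Q = (R 0; M⋆ 1)`, where `R⋆ R = r² - M M⋆`
  obtain ⟨Q, hQ⟩ := hφ.map_nonneg_of_fintype (M := P) (Q := Matrix.fromBlocks R 0 M₀ᴴ 1) <| by
    rw [hP, Matrix.fromBlocks_conjTranspose, Matrix.fromBlocks_multiply]
    simp [← hR]
  have hN : P.map (fun a => (φ a : T.Ambient)) = Matrix.fromBlocks (c • 1) N Nᴴ 1 := by
    -- the lower left corner is `Nᴴ` because a matrix of the form `Qᴴ * Q` is self-adjoint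
    have hsa : (P.map (fun a => (φ a : T.Ambient)))ᴴ = P.map (fun a => (φ a : T.Ambient)) := by
      rw [hQ]; simp
    ext (i | i) (j | j)
    · simp [P, Matrix.one_apply, apply_ite φ, apply_ite (Subtype.val), hφ.map_unit]; simp [unit]
    · simp [P, N]
    · rw [← hsa]; simp [P, N]
    · simp [P, Matrix.one_apply, apply_ite φ, apply_ite (Subtype.val), hφ.map_unit]; simp [unit]
  refine (CStarAlgebra.norm_le_iff_mul_star_le (norm_nonneg _)).2 ?_
  change 0 ≤ CStarMatrix.ofMatrix (c • (1 : Matrix (Fin n) (Fin n) T.Ambient) - N * Nᴴ)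
  let C : Matrix (Fin n ⊕ Fin n) (Fin n) T.Ambient := Matrix.fromRows 1 (-Nᴴ)
  have h : c • 1 - N * Nᴴ = (Q * C)ᴴ * (Q * C) := by
    rw [Matrix.conjTranspose_mul, Matrix.mul_assoc, ← Matrix.mul_assoc _ Q, ← hQ, hN]
    simp [C, Matrix.conjTranspose_fromRows_eq_fromCols_conjTranspose,
      Matrix.fromBlocks_mul_fromRows, Matrix.fromCols_mul_fromRows, sub_eq_add_neg]
  obtain ⟨X, Y, hXY⟩ : ∃ X Y : Matrix (Fin n) (Fin n) T.Ambient, Q * C = Matrix.fromRows X Y :=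
    ⟨_, _, (Matrix.fromRows_toRows _).symm⟩
  rw [h, hXY, Matrix.conjTranspose_fromRows_eq_fromCols_conjTranspose,
    Matrix.fromCols_mul_fromRows]
  exact add_nonneg (CStarMatrix.ofMatrix_nonneg_iff.2 ⟨X, rfl⟩)
    (CStarMatrix.ofMatrix_nonneg_iff.2 ⟨Y, rfl⟩)

theorem norm_toCStarMatrix_one_by_one (a : S.Elem) :
    ‖S.toCStarMatrix (Matrix.of fun _ _ : Fin 1 => a)‖ = ‖a‖ := by
  -- resolving the instances for abstract algebras avoids a slow search on `CStarMatrix`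
  have h {A B : Type w₁} [NonUnitalCStarAlgebra A] [NonUnitalCStarAlgebra B] (e : A ≃⋆ₐ[ℂ] B)
      (x : A) : ‖e x‖ = ‖x‖ := StarAlgEquiv.norm_map e x
  exact h (CStarMatrix.toOneByOne (Fin 1) ℂ S.Ambient) (a : S.Ambient)

theorem IsCompleteIsometry.norm_map {φ : S.Elem →ₗ[ℂ] T.Elem} (hφ : IsCompleteIsometry φ)
    (a : S.Elem) : ‖φ a‖ = ‖a‖ := by
  rw [← norm_toCStarMatrix_one_by_one (φ a), ← norm_toCStarMatrix_one_by_one a]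
  exact hφ 1 _

/-! ### States -/

/-- A state of an operator system: a unital positive linear functional. -/
structure IsState (t : S.Elem →ₗ[ℂ] ℂ) : Prop where
  map_unit : t S.unit = 1
  nonneg : ∀ a : S.Elem, 0 ≤ (a : S.Ambient) → 0 ≤ t a

theorem IsState.comp_isUCP {t : T.Elem →ₗ[ℂ] ℂ} (ht : IsState t) {φ : S.Elem →ₗ[ℂ] T.Elem}
    (hφ : IsUCP φ) : IsState (t ∘ₗ φ) where
  map_unit := by simp [hφ.map_unit, ht.map_unit]
  nonneg a ha := ht.nonneg _ (hφ.nonneg ha)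

theorem IsState.re_le_and_im_eq_zero {t : S.Elem →ₗ[ℂ] ℂ} (ht : IsState t) {a : S.Elem}
    (ha : IsSelfAdjoint (a : S.Ambient)) : (t a).re ≤ ‖a‖ ∧ (t a).im = 0 := by
  have h := ht.nonneg ((‖a‖ : ℂ) • S.unit - a) <| by
    have := ha.le_algebraMap_norm_self
    rw [Algebra.algebraMap_eq_smul_one, ← Complex.coe_smul] at this
    simpa [unit] using this
  rw [map_sub, map_smul, ht.map_unit, Complex.nonneg_iff] at h
  simpa using h

theorem IsState.map_star {t : S.Elem →ₗ[ℂ] ℂ} (ht : IsState t) {a b : S.Elem}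
    (hb : (b : S.Ambient) = star (a : S.Ambient)) : t b = star (t a) := by
  have h := (ht.re_le_and_im_eq_zero (a := a + b) (by simp [hb, IsSelfAdjoint, add_comm])).2
  have h' := (ht.re_le_and_im_eq_zero (a := Complex.I • (a - b)) <| by
    simp [hb, IsSelfAdjoint, ← smul_neg]).2
  simp only [map_add, map_smul, map_sub, Complex.add_im, smul_eq_mul, Complex.I_mul_im,
    Complex.sub_re] at h h'
  apply Complex.ext
  · simp; linarith
  · simp; linarith

/-- States are contractive. -/
theorem IsState.norm_apply_le {t : S.Elem →ₗ[ℂ] ℂ} (ht : IsState t) (a : S.Elem) :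
    ‖t a‖ ≤ ‖a‖ := by
  obtain ⟨c, hc, hca⟩ : ∃ c : ℂ, ‖c‖ = 1 ∧ c * t a = ‖t a‖ := by
    obtain ⟨c, hc, hca⟩ := RCLike.exists_norm_eq_mul_self (t a)
    exact ⟨c, hc, hca.symm⟩
  -- `c` rotates `t a` onto the positive real axis, so only the real part `h` of `c • a` matters
  let b : S.Elem := c • a
  let b' : S.Elem := ⟨star (b : S.Ambient), S.star_mem' b.2⟩
  let h : S.Elem := (2⁻¹ : ℂ) • (b + b')
  have hh := ht.re_le_and_im_eq_zero (a := h) <| by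
    simp [h, b', IsSelfAdjoint, add_comm]
  have hth : t h = ‖t a‖ := by
    have hb : t b = ‖t a‖ := by simp [b, hca]
    rw [map_smul, map_add, ht.map_star (a := b) (b := b') rfl, hb]
    simp
    ring
  have hb' : ‖b'‖ = ‖b‖ := norm_star (b : S.Ambient)
  have hnorm : ‖h‖ ≤ ‖a‖ := calc
    ‖h‖ ≤ ‖(2⁻¹ : ℂ)‖ * (‖b‖ + ‖b'‖) := (norm_smul_le _ _).trans (by gcongr; exact norm_add_le _ _)
    _ = ‖b‖ := by rw [hb']; norm_num; ring
    _ = ‖a‖ := by simp [b, norm_smul, hc]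
  rw [hth, Complex.ofReal_re] at hh
  exact hh.1.trans hnorm

/-- A unital contractive functional is positive.  The zero algebra has no such functional, since
there `‖1‖ = 0`. -/
theorem IsState.of_norm_le {t : S.Elem →ₗ[ℂ] ℂ} (h1 : t S.unit = 1) (ht : ∀ a, ‖t a‖ ≤ ‖a‖) :
    IsState t where
  map_unit := h1
  nonneg a ha := by
    have : Nontrivial S.Ambient := by
      by_contra h
      rw [not_nontrivial_iff_subsingleton] at h
      have h2 := ht S.unit
      rw [h1, Subsingleton.elim S.unit 0] at h2
      norm_num at h2
    have hsa : IsSelfAdjoint (a : S.Ambient) := .of_nonneg ha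
    -- `‖a + i s‖² ≤ ‖a‖² + s²` for all real `s` forces `t a` to be real
    have him (s : ℝ) : ((t a).im + s) ^ 2 ≤ ‖a‖ ^ 2 + s ^ 2 := by
      let b : S.Elem := a + ((s : ℂ) * Complex.I) • S.unit
      have hb : star (b : S.Ambient) * b = (a : S.Ambient) * a + ((s : ℂ) ^ 2) • 1 := by
        have : (s * Complex.I) * (s * Complex.I) = -(s : ℂ) ^ 2 := by
          rw [mul_mul_mul_comm, Complex.I_mul_I]; ring
        simp [b, unit, hsa.star_eq, mul_add, add_mul, smul_smul, this]
      have hb2 : ‖b‖ ^ 2 ≤ ‖a‖ ^ 2 + s ^ 2 := by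
        change ‖(b : S.Ambient)‖ ^ 2 ≤ ‖(a : S.Ambient)‖ ^ 2 + s ^ 2
        rw [sq, ← CStarRing.norm_star_mul_self, hb]
        refine (norm_add_le _ _).trans ?_
        gcongr
        · rw [sq]; exact norm_mul_le _ _
        · simp [norm_smul]
      have hre : ((t a).im + s) ^ 2 ≤ ‖t b‖ ^ 2 := by
        have : (t b).im = (t a).im + s := by simp [b, h1]
        rw [← this, sq_le_sq, abs_norm]
        exact Complex.abs_im_le_norm _
      exact hre.trans ((pow_le_pow_left₀ (norm_nonneg _) (ht b) 2).trans hb2)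
    have him0 : (t a).im = 0 := by
      by_contra hne
      -- at this `s` the cross term is `‖a‖ ^ 2`, which leaves `(t a).im ^ 2 ≤ 0`
      have h := him (‖a‖ ^ 2 / (2 * (t a).im))
      have h3 : 2 * (t a).im * (‖a‖ ^ 2 / (2 * (t a).im)) = ‖a‖ ^ 2 := by field_simp
      have := pow_pos (abs_pos.2 hne) 2
      rw [sq_abs] at this
      nlinarith
    -- `‖‖a‖ - a‖ ≤ ‖a‖` forces it to be nonnegative
    have hre : ‖(‖a‖ : ℂ) • S.unit - a‖ ≤ ‖a‖ := by
      have h2 := hsa.le_algebraMap_norm_self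
      change ‖(‖a‖ : ℂ) • (1 : S.Ambient) - a‖ ≤ ‖(a : S.Ambient)‖
      rw [Complex.coe_smul, ← Algebra.algebraMap_eq_smul_one]
      refine (CStarAlgebra.norm_le_norm_of_nonneg_of_le (sub_nonneg.2 h2)
        (sub_le_self _ ha)).trans ?_
      simp
    have h4 := (Complex.abs_re_le_norm _).trans ((ht _).trans hre)
    rw [map_sub, map_smul, h1] at h4
    have h5 := (abs_le.1 h4).2
    rw [Complex.nonneg_iff]
    simp at h5
    exact ⟨h5, him0.symm⟩

/-- A state extends along a unital isometric map, by the Hahn–Banach theorem. -/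
theorem IsState.exists_extension {s : S.Elem →ₗ[ℂ] ℂ} (hs : IsState s) {κ : S.Elem →ₗ[ℂ] T.Elem}
    (h1 : κ S.unit = T.unit) (hκ : ∀ a, ‖κ a‖ = ‖a‖) :
    ∃ t : T.Elem →ₗ[ℂ] ℂ, IsState t ∧ t ∘ₗ κ = s := by
  let e := (⟨κ, hκ⟩ : S.Elem →ₗᵢ[ℂ] T.Elem).equivRange
  let f : StrongDual ℂ (LinearMap.range κ) :=
    (s.mkContinuous 1 fun a => by simpa using hs.norm_apply_le a).comp
      (e.symm.toContinuousLinearEquiv : LinearMap.range κ →L[ℂ] S.Elem)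
  have hf : ‖f‖ ≤ 1 := f.opNorm_le_bound zero_le_one fun a => by
    simpa [f] using hs.norm_apply_le (e.symm a)
  obtain ⟨t, ht, htn⟩ := exists_extension_norm_eq (LinearMap.range κ) f
  have hκt (a : S.Elem) : t (κ a) = s a := by
    have := ht (e a)
    simp only [f, ContinuousLinearMap.comp_apply, LinearMap.mkContinuous_apply] at this
    change t (κ a) = s (e.symm (e a)) at this
    rwa [e.symm_apply_apply] at this
  refine ⟨t, .of_norm_le ?_ fun a => ?_, LinearMap.ext hκt⟩
  · rw [← h1]; exact (hκt _).trans hs.map_unit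
  · simpa using t.le_of_opNorm_le (htn.trans_le hf) a

/-! ### Maps into bounded functions -/

/-- A family of states, indexed by `X`, as a map into the bounded functions on `X`. -/
noncomputable def stateFamily {X : Type u} (t : X → S.Elem →ₗ[ℂ] ℂ) (ht : ∀ x, IsState (t x)) :
    S.Elem →ₗ[ℂ] (ellInftySystem X).Elem where
  toFun a := ⟨⟨fun x => t x a, memℓp_infty
    ⟨‖a‖, by rintro _ ⟨x, rfl⟩; exact (ht x).norm_apply_le a⟩⟩, trivial⟩
  map_add' a b := by
    apply Subtype.ext; apply lp.ext; funext x; exact map_add (t x) a b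
  map_smul' c a := by
    apply Subtype.ext; apply lp.ext; funext x; exact map_smul (t x) c a

/-- Evaluation of bounded functions at a point. -/
noncomputable def ellInftyEval {X : Type u} (x : X) : (ellInftySystem X).Elem →ₗ[ℂ] ℂ where
  toFun f := (show EllInfty X from f.1) x
  map_add' _ _ := rfl
  map_smul' _ _ := rfl

theorem ellInfty_ext {X : Type u} {f g : (ellInftySystem X).Elem}
    (h : ∀ x, ellInftyEval x f = ellInftyEval x g) : f = g :=
  Subtype.ext (lp.ext (funext h))

theorem isState_ellInftyEval {X : Type u} (x : X) : IsState (ellInftyEval x) where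
  map_unit := rfl
  nonneg a ha := by
    obtain ⟨b, hb⟩ := CStarAlgebra.nonneg_iff_exists_star_mul_self.1 ha
    have h : ellInftyEval x a = star ((show EllInfty X from b) x) * (show EllInfty X from b) x :=
      congrArg (fun f : EllInfty X => f x) hb
    rw [h]
    exact star_mul_self_nonneg _

/-- A state maps positive matrices to positive semidefinite matrices. -/
theorem IsState.posSemidef {t : S.Elem →ₗ[ℂ] ℂ} (ht : IsState t) {n : ℕ}
    {M : Matrix (Fin n) (Fin n) S.Elem} (hM : 0 ≤ S.toCStarMatrix M) :
    (M.map t).PosSemidef := by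
  obtain ⟨Q, hQ⟩ := toCStarMatrix_nonneg_iff.1 hM
  have hQ' (i j : Fin n) : (M i j : S.Ambient) = ∑ k, star (Q k i) * Q k j := by
    simpa [Matrix.mul_apply] using congrFun (congrFun hQ i) j
  refine Matrix.posSemidef_iff_dotProduct_mulVec.2 ⟨?_, fun x => ?_⟩
  · ext i j
    rw [Matrix.conjTranspose_apply, Matrix.map_apply, Matrix.map_apply]
    exact (ht.map_star (by simp [hQ'])).symm
  · have h : star x ⬝ᵥ (M.map t) *ᵥ x = t (∑ i, ∑ j, (star (x i) * x j) • M i j) := by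
      simp only [dotProduct, Matrix.mulVec, Pi.star_apply, Matrix.map_apply, Finset.mul_sum,
        map_sum, map_smul, smul_eq_mul]
      exact Finset.sum_congr rfl fun i _ => Finset.sum_congr rfl fun j _ => by ring
    rw [h]
    refine ht.nonneg _ ?_
    have h' : ((∑ i, ∑ j, (star (x i) * x j) • M i j : S.Elem) : S.Ambient) =
        ∑ k, star (∑ i, x i • Q k i) * ∑ j, x j • Q k j := by
      simp only [Submodule.coe_sum, Submodule.coe_smul, hQ', star_sum, star_smul,
        Finset.sum_mul_sum, Finset.smul_sum, smul_mul_smul_comm]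
      exact (Finset.sum_congr rfl fun i _ => Finset.sum_comm).trans Finset.sum_comm
    rw [h']
    exact Finset.sum_nonneg fun k _ => star_mul_self_nonneg _

open scoped MatrixOrder in
theorem _root_.Matrix.PosSemidef.exists_eq_conjTranspose_mul_self {n : Type*} [Fintype n]
    {M : Matrix n n ℂ} (hM : M.PosSemidef) : ∃ R : Matrix n n ℂ, M = Rᴴ * R := by
  classical exact CStarAlgebra.nonneg_iff_eq_star_mul_self.1 hM.nonneg

/-- A family of states, as a map into the bounded functions, is completely positive: the square
roots of the pointwise values of a positive matrix are uniformly bounded, so that they form a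
matrix of bounded functions. -/
theorem isUCP_stateFamily {X : Type u} (t : X → S.Elem →ₗ[ℂ] ℂ) (ht : ∀ x, IsState (t x)) :
    IsUCP (stateFamily t ht) where
  map_unit := ellInfty_ext fun x => (ht x).map_unit
  map_nonneg n M hM := by
    choose R hR using
      fun x => ((ht x).posSemidef hM).exists_eq_conjTranspose_mul_self
    have hbound (x : X) (i j : Fin n) : ‖R x i j‖ ≤ √‖M j j‖ := by
      refine Real.le_sqrt_of_sq_le ?_
      have h1 : ((∑ k, ‖R x k j‖ ^ 2 : ℝ) : ℂ) = t x (M j j) := by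
        have := congrFun (congrFun (hR x) j) j
        simp only [Matrix.map_apply, Matrix.mul_apply, Matrix.conjTranspose_apply] at this
        rw [this]
        push_cast
        refine Finset.sum_congr rfl fun k _ => ?_
        exact (Complex.conj_mul' _).symm
      calc ‖R x i j‖ ^ 2 ≤ ∑ k, ‖R x k j‖ ^ 2 :=
            Finset.single_le_sum (f := fun k => ‖R x k j‖ ^ 2) (fun _ _ => sq_nonneg _)
              (Finset.mem_univ i)
        _ ≤ ‖t x (M j j)‖ := by
            rw [← h1, Complex.norm_real]
            exact le_abs_self _
        _ ≤ ‖M j j‖ := (ht x).norm_apply_le _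
    let Q : Matrix (Fin n) (Fin n) (EllInfty X) := Matrix.of fun i j =>
      ⟨fun x => R x i j, memℓp_infty ⟨_, by rintro _ ⟨x, rfl⟩; exact hbound x i j⟩⟩
    refine toCStarMatrix_nonneg_iff.2 ⟨Q, ?_⟩
    ext i j
    apply lp.ext
    funext x
    have hQ : ((Qᴴ * Q) i j : EllInfty X) x = ((R x)ᴴ * R x) i j := by
      simp only [Matrix.mul_apply, lp.coeFn_sum, Finset.sum_apply]
      rfl
    exact (congrFun (congrFun (hR x) i) j).trans hQ.symm

/-- `ℓ^∞(X)` is injective: extend the coordinates of a map one at a time. -/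
theorem exists_isUCP_extension {X : Type u} {κ : S.Elem →ₗ[ℂ] T.Elem}
    (h1 : κ S.unit = T.unit) (hκ : ∀ a, ‖κ a‖ = ‖a‖) {φ : S.Elem →ₗ[ℂ] (ellInftySystem X).Elem}
    (hφ : IsUCP φ) : ∃ ψ : T.Elem →ₗ[ℂ] (ellInftySystem X).Elem, IsUCP ψ ∧ ψ ∘ₗ κ = φ := by
  choose t ht htκ using fun x : X =>
    ((isState_ellInftyEval x).comp_isUCP hφ).exists_extension h1 hκ
  exact ⟨stateFamily t ht, isUCP_stateFamily t ht,
    LinearMap.ext fun a => ellInfty_ext fun x => LinearMap.congr_fun (htκ x) a⟩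

/-! ### Rigidity of the inclusion of `c₀(X) + ℂ1` -/

theorem isUCP_c₀UnitizationIncl (X : Type u) : IsUCP (c₀UnitizationIncl X) :=
  .of_starAlgHom (S := c₀UnitizationSystem X) (T := ellInftySystem X)
    (StarAlgHom.id ℂ (EllInfty X)) fun _ => rfl

theorem isCompleteIsometry_c₀UnitizationIncl (X : Type u) :
    IsCompleteIsometry (c₀UnitizationIncl X) := fun _ _ => rfl

theorem single_mem_c₀ {X : Type u} [DecidableEq X] (x : X) (c : ℂ) :
    (lp.single ∞ x c : EllInfty X) ∈ c₀ X := by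
  change Filter.Tendsto _ _ _
  refine tendsto_const_nhds.congr' ?_
  filter_upwards [(Set.finite_singleton x).compl_mem_cofinite] with y hy
  simp [lp.single_apply, Pi.single_eq_of_ne (show y ≠ x from hy)]

/-- A state of `ℓ^∞(X)` that agrees with the evaluation at `x` on `c₀(X) + ℂ1` is the evaluation at
`x`.  If `g` vanishes at `x` then `‖‖g‖ δ_x + c g‖ ≤ ‖g‖` for `|c| = 1`, so that
`‖g‖ + |s g| ≤ ‖g‖`. -/
theorem IsState.eq_ellInftyEval {X : Type u} {s : (ellInftySystem X).Elem →ₗ[ℂ] ℂ}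
    (hs : IsState s) {x : X}
    (hx : s ∘ₗ c₀UnitizationIncl X = ellInftyEval x ∘ₗ c₀UnitizationIncl X) :
    s = ellInftyEval x := by
  classical
  have hvanish (g : (ellInftySystem X).Elem) (hg : ellInftyEval x g = 0) : s g = 0 := by
    obtain ⟨c, hc, hcg⟩ : ∃ c : ℂ, ‖c‖ = 1 ∧ c * s g = ‖s g‖ := by
      obtain ⟨c, hc, hcg⟩ := RCLike.exists_norm_eq_mul_self (s g)
      exact ⟨c, hc, hcg.symm⟩
    let d : EllInfty X := lp.single ∞ x (‖g‖ : ℂ)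
    have hdmem : d ∈ c₀Unitization X := StarAlgebra.subset_adjoin ℂ _ (single_mem_c₀ x _)
    have hd : s ⟨d, trivial⟩ = ‖g‖ := by
      have h := LinearMap.congr_fun hx ⟨d, hdmem⟩
      refine h.trans ?_
      change d x = _
      simp [d]
    have hle : ‖(⟨d, trivial⟩ + c • g : (ellInftySystem X).Elem)‖ ≤ ‖g‖ := by
      refine lp.norm_le_of_forall_le (f := d + c • (show EllInfty X from g.1)) (norm_nonneg _)
        fun y => ?_
      change ‖d y + c * (show EllInfty X from g.1) y‖ ≤ _
      by_cases hy : y = x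
      · subst hy
        have : (show EllInfty X from g.1) y = 0 := hg
        simp [this, d]
      · have : d y = 0 := by simp [d, lp.single_apply, Pi.single_eq_of_ne hy]
        rw [this, zero_add, norm_mul, hc, one_mul]
        exact lp.norm_apply_le_norm ENNReal.top_ne_zero (show EllInfty X from g.1) y
    have h := (hs.norm_apply_le _).trans hle
    rw [map_add, map_smul, hd, smul_eq_mul, hcg, ← Complex.ofReal_add, Complex.norm_real,
      Real.norm_of_nonneg (by positivity)] at h
    exact norm_le_zero_iff.1 (by linarith)
  refine LinearMap.ext fun f => ?_
  have h1 : ellInftyEval x (ellInftySystem X).unit = 1 := (isState_ellInftyEval x).map_unit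
  have h := hvanish (f - ellInftyEval x f • (ellInftySystem X).unit) (by simp [h1])
  rw [map_sub, map_smul, hs.map_unit, smul_eq_mul, mul_one, sub_eq_zero] at h
  exact h

/-- The inclusion of `c₀(X) + ℂ1` is essential.  If `φ` is completely isometric on `c₀(X) + ℂ1`,
then injectivity of `ℓ^∞(X)` gives a u.c.p. map `ψ` with `ψ ∘ φ` the identity on `c₀(X) + ℂ1`, hence
on `ℓ^∞(X)`, and `φ` has a completely contractive left inverse. -/
theorem isCompleteIsometry_of_comp_c₀UnitizationIncl {X : Type u}
    {φ : (ellInftySystem X).Elem →ₗ[ℂ] T.Elem} (hφ : IsUCP φ)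
    (h : IsCompleteIsometry (φ ∘ₗ c₀UnitizationIncl X)) : IsCompleteIsometry φ := by
  obtain ⟨ψ, hψ, hψφ⟩ := exists_isUCP_extension (κ := φ ∘ₗ c₀UnitizationIncl X)
    (by rw [LinearMap.comp_apply, (isUCP_c₀UnitizationIncl X).map_unit, hφ.map_unit])
    h.norm_map (isUCP_c₀UnitizationIncl X)
  have hid (f : (ellInftySystem X).Elem) : ψ (φ f) = f := ellInfty_ext fun x => by
    have hs : IsState (ellInftyEval x ∘ₗ ψ ∘ₗ φ) :=
      ((isState_ellInftyEval x).comp_isUCP hψ).comp_isUCP hφ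
    refine LinearMap.congr_fun (hs.eq_ellInftyEval ?_) f
    rw [LinearMap.comp_assoc, LinearMap.comp_assoc, hψφ]
  intro n M
  refine le_antisymm (hφ.norm_map_le M) ?_
  have hM : (M.map φ).map ψ = M := by ext1 i j; exact hid _
  simpa only [hM] using hψ.norm_map_le (M.map φ)

/-- `ℓ^∞(X)` is the injective envelope of `c₀(X) + ℂ1`. -/
theorem isInjectiveEnvelope_c₀UnitizationIncl (X : Type u) :
    IsInjectiveEnvelope.{w} (c₀UnitizationIncl X) where
  isExtension := ⟨⟨isUCP_c₀UnitizationIncl X, fun _ _ => rfl⟩,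
    isCompleteIsometry_c₀UnitizationIncl X⟩
  isGEssential _ _ hφ h := isCompleteIsometry_of_comp_c₀UnitizationIncl hφ.isUCP h
  isGInjective E F κ φ hκ hφ := by
    obtain ⟨ψ, hψ, hψκ⟩ := exists_isUCP_extension hκ.isGMorphism.isUCP.map_unit
      hκ.isCompleteIsometry.norm_map hφ.isUCP
    refine ⟨ψ, ⟨hψ, fun g a => ?_⟩, hψκ⟩
    obtain rfl : g = 1 := rfl
    simp only [map_one, Module.End.one_apply]

end OperatorSystem

namespace GOperatorSystem

open OperatorSystem

variable {G : Type v} [Group G]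

/-! ### Averaging over an amenable subgroup -/

/-- A state of a `G`-operator system can be averaged over an amenable subgroup `H`.  Where the state
is already constant on `H`-orbits, its value is unchanged. -/
theorem exists_invariant_state {F : GOperatorSystem.{v, w} G} {H : Subgroup G}
    (hH : IsAmenableGroup H) {t : F.Elem →ₗ[ℂ] ℂ} (ht : IsState t) :
    ∃ t' : F.Elem →ₗ[ℂ] ℂ, IsState t' ∧ (∀ (h : H) (a : F.Elem), t' (F.act (h : G) a) = t' a) ∧
      ∀ a : F.Elem, (∀ h : H, t (F.act (h : G) a) = t a) → t' a = t a := by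
  obtain ⟨m, hm1, hmpos, hminv⟩ := hH
  have hst (h : H) : IsState (t ∘ₗ F.act (h : G)⁻¹) := ht.comp_isUCP (F.act_isUCP _)
  let f : F.Elem →ₗ[ℂ] (ellInftySystem H).Elem := stateFamily _ hst
  let t' : F.Elem →ₗ[ℂ] ℂ :=
    m ∘ₗ (Submodule.subtype _ : (ellInftySystem H).Elem →ₗ[ℂ] EllInfty H) ∘ₗ f
  refine ⟨t', ⟨?_, fun a ha => ?_⟩, fun h a => ?_, fun a ha => ?_⟩
  · refine Eq.trans (congrArg m ?_) hm1
    exact congrArg Subtype.val (isUCP_stateFamily _ hst).map_unit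
  · have h := hmpos (f a).1 fun h => by
      have := Complex.nonneg_iff.1 ((hst h).nonneg a ha)
      exact ⟨this.1, this.2.symm⟩
    exact Complex.nonneg_iff.2 ⟨h.1, h.2.symm⟩
  · refine Eq.trans (congrArg m ?_) (hminv h (f a).1)
    apply lp.ext
    funext k
    change t (F.act (k : G)⁻¹ (F.act (h : G) a)) = t (F.act ((h⁻¹ * k : H) : G)⁻¹ a)
    rw [← Module.End.mul_apply, ← map_mul]
    simp
  · have hfa : (f a).1 = t a • (1 : EllInfty H) := by
      apply lp.ext
      funext k
      change t (F.act (k : G)⁻¹ a) = t a * 1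
      rw [mul_one]
      exact ha k⁻¹
    change m (f a).1 = t a
    rw [hfa, map_smul, hm1, smul_eq_mul, mul_one]

/-- If `H` is amenable, `ℓ^∞(G/H)` is `G`-injective: `G`-equivariant u.c.p. maps into it correspond
to `H`-invariant states, by evaluation at the coset `H`, and an extension of an `H`-invariant state
can be averaged over `H`. -/
theorem isGInjective_ellInftyGSystem {H : Subgroup G} (hH : IsAmenableGroup H) :
    IsGInjective.{v, w} (ellInftyGSystem G (G ⧸ H)) := by
  intro E F κ φ hκ hφ
  have hact (g : G) (f : (ellInftySystem (G ⧸ H)).Elem) (q : G ⧸ H) :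
      ellInftyEval q ((ellInftyGSystem G (G ⧸ H)).act g f) = ellInftyEval (g⁻¹ • q) f := rfl
  let o : G ⧸ H := (1 : G)
  obtain ⟨t, ht, htκ⟩ := ((isState_ellInftyEval o).comp_isUCP hφ.isUCP).exists_extension
    hκ.isGMorphism.isUCP.map_unit hκ.isCompleteIsometry.norm_map
  obtain ⟨t', ht', hinv, hfix⟩ := exists_invariant_state hH ht
  have htκ' (a : E.Elem) : t (κ a) = ellInftyEval o (φ a) := LinearMap.congr_fun htκ a
  have ht'κ (a : E.Elem) : t' (κ a) = ellInftyEval o (φ a) := by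
    rw [hfix, htκ']
    intro h
    rw [← hκ.isGMorphism.equivariant, htκ', htκ', hφ.equivariant]
    refine (hact _ _ _).trans ?_
    have : (h : G)⁻¹ • o = o := by
      simp [o, QuotientGroup.eq]
    rw [this]
  -- the value of the extension at a coset does not depend on the representative
  have hout (g : G) (a : F.Elem) :
      t' (F.act (g : G ⧸ H).out⁻¹ a) = t' (F.act g⁻¹ a) := by
    obtain ⟨h, hh⟩ := QuotientGroup.mk_out_eq_mul H g
    rw [hh, mul_inv_rev, map_mul, Module.End.mul_apply]
    exact hinv h⁻¹ _
  have hst (q : G ⧸ H) : IsState (t' ∘ₗ F.act q.out⁻¹) := ht'.comp_isUCP (F.act_isUCP _)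
  have hψ (g : G) (a : F.Elem) :
      ellInftyEval (g : G ⧸ H) (stateFamily _ hst a) = t' (F.act g⁻¹ a) := hout g a
  refine ⟨stateFamily _ hst, ⟨isUCP_stateFamily _ hst, fun g a => ?_⟩, LinearMap.ext fun a => ?_⟩
  · refine ellInfty_ext fun q => ?_
    induction q using QuotientGroup.induction_on with | H k => ?_
    refine Eq.trans ?_ (hact _ _ _).symm
    refine (hψ k _).trans (Eq.trans ?_ (hψ (g⁻¹ * k) a).symm)
    rw [← Module.End.mul_apply, ← map_mul]
    simp
  · refine ellInfty_ext fun q => ?_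
    induction q using QuotientGroup.induction_on with | H k => ?_
    refine (hψ k (κ a)).trans ?_
    rw [← hκ.isGMorphism.equivariant, ht'κ, hφ.equivariant]
    refine (hact _ _ _).trans ?_
    simp [o]

/-- For amenable `H`, `ℓ^∞(G/H)` is the `G`-injective envelope of `c₀(G/H) + ℂ1`. -/
theorem isGInjectiveEnvelope_c₀UnitizationGIncl {H : Subgroup G} (hH : IsAmenableGroup H) :
    IsGInjectiveEnvelope.{v, w} (c₀UnitizationGIncl G (G ⧸ H)) where
  isExtension := ⟨⟨isUCP_c₀UnitizationIncl _, fun _ _ => rfl⟩,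
    isCompleteIsometry_c₀UnitizationIncl _⟩
  isGEssential _ _ hφ h := isCompleteIsometry_of_comp_c₀UnitizationIncl hφ.isUCP h
  isGInjective := isGInjective_ellInftyGSystem hH

end GOperatorSystem

theorem mainTheorem7 :
    (∀ X : Type u,
      OperatorSystem.IsInjectiveEnvelope.{w} (c₀UnitizationIncl X)) ∧
    (∀ (G : Type v) [Group G] (H : Subgroup G), IsAmenableGroup H →
      GOperatorSystem.IsGInjectiveEnvelope.{v, w} (c₀UnitizationGIncl G (G ⧸ H))) :=
  ⟨fun X => OperatorSystem.isInjectiveEnvelope_c₀UnitizationIncl X,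
    fun _ _ _ hH => GOperatorSystem.isGInjectiveEnvelope_c₀UnitizationGIncl hH⟩
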